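/- Let $(K,v)$ be a Henselian discrete valued field: the value group $v(K)$ is infinite cyclic, and for every algebraic extension $L/K$ the valuation $v$ extends, uniquely up to equivalence, to a valuation of $L$. Suppose that the residue field $\widehat K$ of $(K,v)$ is infinite and has characteristic $p>0$. Then for every integer $\mu\ge 1$ there is a finite Galois extension $M_\mu/K$ of degree $[M_\mu:K]=p^\mu$ such that the Galois group $\mathcal G(M_\mu/K)$ is abelian of period (that is, exponent) $p$, and $M_\mu/K$ is totally ramified: $v$ has, up to equivalence, a unique prolongation $v_{M_\mu}$ to $M_\mu$, and the index of $v(K)$ in $v_{M_\mu}(M_\mu)$ equals $[M_\mu:K]$. -/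

import Mathlib

universe u w

namespace HDV

section

variable {K : Type u} [Field K] {Γ₀ : Type w} [LinearOrderedCommGroupWithZero Γ₀]

/-- Valuations of a field `L`, up to equivalence, are the same as valuation subrings of `L`.
The class given by `B` extends (the class of) the valuation `v` of the subfield `K` exactly when
the elements of `K` that lie in `B` are those of the valuation ring of `v`. -/
def Extends (v : Valuation K Γ₀) {L : Type u} [Field L] [Algebra K L]
    (B : ValuationSubring L) : Prop :=
  B.comap (algebraMap K L) = v.valuationSubring

/-- `v` is Henselian: it extends uniquely, up to equivalence, to every algebraic extension of `K`.
(Every algebraic extension of `K` is isomorphic to one in the universe of `K`.) -/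
def IsHenselian (v : Valuation K Γ₀) : Prop :=
  ∀ (L : Type u) [Field L] [Algebra K L] [Algebra.IsAlgebraic K L],
    ∃! B : ValuationSubring L, Extends v B

/-- The image of `Kˣ` in the value group of the valuation of `L` with valuation ring `B`. -/
noncomputable def baseValueGroup (K : Type u) [Field K] {L : Type u} [Field L] [Algebra K L]
    (B : ValuationSubring L) : Subgroup B.ValueGroupˣ :=
  (Units.map ((B.valuation : L →* B.ValueGroup).comp (algebraMap K L : K →* L))).range

/-- The index of the value group of `K` in the value group of `L` (it is `0` if it is infinite). -/
noncomputable def ramificationIndex (K : Type u) [Field K] {L : Type u} [Field L] [Algebra K L]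
    (B : ValuationSubring L) : ℕ :=
  (baseValueGroup K B).index

/-- The finite extension `L / K` is totally ramified with respect to `v`: up to equivalence, `v`
has a unique prolongation to `L`, and the index of the value group of `K` in that of `L` is the
degree of `L / K`. -/
def IsTotallyRamified (v : Valuation K Γ₀) (L : Type u) [Field L] [Algebra K L] : Prop :=
  FiniteDimensional K L ∧
    ∃ B : ValuationSubring L, Extends v B ∧ (∀ B' : ValuationSubring L, Extends v B' → B' = B) ∧
      ramificationIndex K B = Module.finrank K L

end

end HDV

/-! Choose an additive subgroup `V` of order `q = p^μ` in the residue field, lift its elements to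
integers `c a` with `c 0 = 0`, and let `M` be the splitting field of `G = ∏ (X - c a) - π⁻¹`, with
`π` a uniformizer. A root `x` satisfies `w x ^ q = (w π)⁻¹`, so `q` divides the ramification index,
which is at most `[M : K]`. For the reverse bound, the reduction of `F = ∏ (X - c a)` is an additive
polynomial. The errors made in lifting lie in the maximal ideal, hence have value at most `w π`, and
they stay small when multiplied by `x ^ i` with `i < q`. So `F (t + x) - F x` is `F t` up to terms
`d_j t ^ j` with `w d_j < 1`. Two roots of `G` therefore differ by some `c a` modulo the maximal
ideal, with `a = 0` only if they coincide. Uniqueness of the prolongation makes `w` compatible with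
the Galois action, so `σ ↦ a` is an injective homomorphism of the Galois group into `V`. This bounds
the degree by `q` and gives commutativity and exponent `p`. -/

open Polynomial

/-! ### Additive polynomials over the residue field -/

section AdditivePolynomial

variable {k : Type*} [Field k] (V : AddSubgroup k) [Fintype V]

/-- The polynomial whose roots are the elements of a finite additive subgroup is additive. -/
theorem taylor_prod_X_sub_C_addSubgroup (s : k) :
    taylor s (∏ a : V, (X - C (a : k))) =
      ∏ a : V, (X - C (a : k)) + C ((∏ a : V, (X - C (a : k))).eval s) := by
  classical
  set P : k[X] := ∏ a : V, (X - C (a : k)) with hP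
  have hPm : P.Monic := monic_prod_of_monic _ _ fun a _ => monic_X_sub_C _
  have hPd : P.natDegree = Fintype.card V := by
    rw [hP, natDegree_prod_of_monic _ _ fun a _ => monic_X_sub_C _]; simp
  have hPd' : P.degree = Fintype.card V := by
    rw [degree_eq_natDegree hPm.ne_zero, hPd]
  have hcard : (Finset.univ.map ⟨((↑) : V → k), Subtype.val_injective⟩).card = Fintype.card V := by
    simp
  have hpos : 0 < Fintype.card V := Fintype.card_pos
  have hCd : (C (P.eval s)).degree < P.degree := by
    rw [hPd']
    exact lt_of_le_of_lt degree_C_le (by exact_mod_cast hpos)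
  have hPC : (P + C (P.eval s)).degree = P.degree := degree_add_eq_left_of_degree_lt hCd
  -- The leading terms cancel, so the difference has degree below `|V|`; it vanishes on `V` because
  -- translation by `b` permutes `V`.
  refine eq_of_degree_sub_lt_of_eval_finset_eq
    (Finset.univ.map ⟨((↑) : V → k), Subtype.val_injective⟩) ?_ ?_
  · rw [hcard, ← hPd', ← degree_taylor P s]
    refine degree_sub_lt_left ?_ ?_ ?_
    · rw [degree_taylor, hPC]
    · rw [Ne, ← degree_eq_bot, degree_taylor, degree_eq_bot]; exact hPm.ne_zero
    · rw [leadingCoeff_taylor, leadingCoeff_add_of_degree_lt' hCd]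
  · intro b hb
    obtain ⟨b, -, rfl⟩ := Finset.mem_map.1 hb
    have h0 : P.eval (b : k) = 0 := by
      rw [hP, eval_prod]
      exact Finset.prod_eq_zero (Finset.mem_univ b) (by simp)
    have h1 : P.eval ((b : k) + s) = P.eval s := by
      rw [hP, eval_prod, eval_prod]
      refine Fintype.prod_equiv (Equiv.subRight b) _ _ fun a => ?_
      simp; ring
    simp only [Function.Embedding.coeFn_mk, taylor_eval, eval_add, eval_C, h0, h1, zero_add]

theorem hasseDeriv_prod_X_sub_C_addSubgroup [Infinite k] {j : ℕ} (hj : j ≠ 0) :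
    hasseDeriv j (∏ a : V, (X - C (a : k))) = C ((∏ a : V, (X - C (a : k))).coeff j) := by
  refine Polynomial.funext fun s => ?_
  rw [← taylor_coeff, taylor_prod_X_sub_C_addSubgroup, coeff_add, coeff_C, if_neg hj, add_zero,
    eval_C]

end AdditivePolynomial

theorem hasseDeriv_map' {R S : Type*} [Semiring R] [Semiring S] (φ : R →+* S) (j : ℕ)
    (f : R[X]) : hasseDeriv j (f.map φ) = (hasseDeriv j f).map φ := by
  ext n
  simp [hasseDeriv_coeff]

/-- If the reduction of `f` has constant Hasse derivative, then the `j`-th Taylor coefficient of `f`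
at a mildly non-integral `x` is close to the `j`-th coefficient of `f`. -/
theorem valuation_taylor_coeff_sub_lt_one {A M Γ : Type*} [CommRing A] [IsLocalRing A] [Field M]
    [LinearOrderedCommGroupWithZero Γ] (w : Valuation M Γ) (φ : A →+* M) {ρ : Γ}
    (hφ : ∀ a ∈ IsLocalRing.maximalIdeal A, w (φ a) ≤ ρ) (f : A[X]) {x : M}
    (hx : ∀ i < f.natDegree, ρ * w x ^ i < 1) {j : ℕ} (hj : j ≠ 0)
    (hf : hasseDeriv j (f.map (IsLocalRing.residue A)) =
      C ((f.map (IsLocalRing.residue A)).coeff j)) :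
    w ((taylor x (f.map φ)).coeff j - (f.map φ).coeff j) < 1 := by
  rw [taylor_coeff, hasseDeriv_map', eval_map, eval₂_eq_sum_range, Finset.sum_range_succ']
  have h0 : (hasseDeriv j f).coeff 0 = f.coeff j := by simp [hasseDeriv_coeff]
  rw [h0, pow_zero, mul_one, coeff_map, add_sub_cancel_right]
  refine w.map_sum_lt one_ne_zero fun i hi => ?_
  have hi' : i + 1 ≤ f.natDegree - j :=
    (Finset.mem_range.1 hi).trans_le (natDegree_hasseDeriv_le f j)
  have hmem : (hasseDeriv j f).coeff (i + 1) ∈ IsLocalRing.maximalIdeal A := by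
    rw [← IsLocalRing.residue_eq_zero_iff, ← coeff_map, ← hasseDeriv_map', hf, coeff_C,
      if_neg (Nat.succ_ne_zero i)]
  rw [map_mul, map_pow]
  exact (mul_le_mul_left (hφ _ hmem) _).trans_lt (hx (i + 1) (by omega))

/-! ### Differences of roots of a perturbed additive polynomial -/

section RootDifference

variable {M Γ ι : Type*} [Field M] [LinearOrderedCommGroupWithZero Γ] (w : Valuation M Γ)
  [Fintype ι] {c : ι → M} {x t : M}

theorem eval_add_sub_eval (F : M[X]) (x t : M) :
    F.eval (t + x) - F.eval x = F.eval t - F.eval 0 +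
      ∑ j ∈ Finset.range F.natDegree,
        ((taylor x F).coeff (j + 1) - F.coeff (j + 1)) * t ^ (j + 1) := by
  rw [← taylor_eval, eval_eq_sum_range (p := taylor x F), natDegree_taylor,
    eval_eq_sum_range (p := F) t, Finset.sum_range_succ', Finset.sum_range_succ',
    taylor_coeff_zero, ← coeff_zero_eq_eval_zero]
  simp only [sub_mul, Finset.sum_sub_distrib]
  ring

theorem valuation_eval_prod_eq_pow (hc : ∀ a, w (c a) ≤ 1) (ht : 1 < w t) :
    w ((∏ a, (X - C (c a))).eval t) = w t ^ Fintype.card ι := by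
  rw [eval_prod, map_prod, Finset.prod_congr rfl (g := fun _ => w t), Finset.prod_const,
    Finset.card_univ]
  intro a _
  simp only [eval_sub, eval_X, eval_C]
  exact w.map_sub_eq_of_lt_left ((hc a).trans_lt ht)

theorem natDegree_prod_X_sub_C' (c : ι → M) :
    (∏ a, (X - C (c a))).natDegree = Fintype.card ι := by
  rw [natDegree_prod_of_monic _ _ fun a _ => monic_X_sub_C _]; simp

theorem eval_zero_prod_X_sub_C {i₀ : ι} (h0 : c i₀ = 0) : (∏ a, (X - C (c a))).eval 0 = 0 := by
  rw [eval_prod]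
  exact Finset.prod_eq_zero (Finset.mem_univ i₀) (by simp [h0])

variable (hD : ∀ j ≠ 0, w ((taylor x (∏ a, (X - C (c a)))).coeff j -
    (∏ a, (X - C (c a))).coeff j) < 1)

include hD

/-- If `w t > 1`, the value `w t ^ q` of the product at `t` exceeds every error term `d_j t ^ j`
with `j ≤ q`, so the two cannot cancel. -/
theorem valuation_le_one_of_eval_add_eq {i₀ : ι} (h0 : c i₀ = 0) (hc : ∀ a, w (c a) ≤ 1)
    (ht : (∏ a, (X - C (c a))).eval (t + x) = (∏ a, (X - C (c a))).eval x) : w t ≤ 1 := by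
  by_contra! h
  have key := eval_add_sub_eval (∏ a, (X - C (c a))) x t
  rw [ht, sub_self, eval_zero_prod_X_sub_C h0, sub_zero] at key
  have h1 := valuation_eval_prod_eq_pow w hc h
  rw [eq_neg_of_add_eq_zero_left key.symm, w.map_neg] at h1
  refine absurd h1 (ne_of_lt ?_)
  refine w.map_sum_lt (pow_ne_zero _ (zero_lt_one.trans h).ne') fun j hj => ?_
  rw [natDegree_prod_X_sub_C', Finset.mem_range] at hj
  rw [map_mul, map_pow]
  calc _ < 1 * w t ^ (j + 1) :=
        mul_lt_mul_of_pos_right (hD _ j.succ_ne_zero) (pow_pos (zero_lt_one.trans h) _)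
    _ ≤ w t ^ Fintype.card ι := by rw [one_mul]; exact pow_le_pow_right₀ h.le hj

theorem valuation_eval_lt_of_eval_add_eq {i₀ : ι} (h0 : c i₀ = 0) (htne : t ≠ 0) (ht1 : w t ≤ 1)
    (ht : (∏ a, (X - C (c a))).eval (t + x) = (∏ a, (X - C (c a))).eval x) :
    w ((∏ a, (X - C (c a))).eval t) < w t := by
  have key := eval_add_sub_eval (∏ a, (X - C (c a))) x t
  rw [ht, sub_self, eval_zero_prod_X_sub_C h0, sub_zero] at key
  have hw0 : w t ≠ 0 := w.ne_zero_iff.2 htne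
  rw [eq_neg_of_add_eq_zero_left key.symm, w.map_neg]
  refine w.map_sum_lt hw0 fun j hj => ?_
  rw [map_mul, map_pow]
  calc _ < 1 * w t ^ (j + 1) :=
        mul_lt_mul_of_pos_right (hD _ j.succ_ne_zero) (pow_pos (zero_lt_iff.2 hw0) _)
    _ ≤ w t := by rw [one_mul]; exact pow_le_of_le_one zero_le ht1 j.succ_ne_zero

theorem exists_valuation_sub_lt_one_of_eval_add_eq {i₀ : ι} (h0 : c i₀ = 0)
    (hc : ∀ a, w (c a) ≤ 1)
    (ht : (∏ a, (X - C (c a))).eval (t + x) = (∏ a, (X - C (c a))).eval x) :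
    ∃ a, w (t - c a) < 1 := by
  rcases eq_or_ne t 0 with rfl | htne
  · exact ⟨i₀, by simp [h0]⟩
  have ht1 := valuation_le_one_of_eval_add_eq w hD h0 hc ht
  have := valuation_eval_lt_of_eval_add_eq w hD h0 htne ht1 ht
  by_contra! h
  -- All factors would have value at least `1`, hence so would the product, whose value is below `w
  -- t ≤ 1`.
  rw [eval_prod, map_prod] at this
  simp only [eval_sub, eval_X, eval_C] at this
  exact absurd (this.trans_le ht1) (not_lt.2 (Finset.prod_induction _ (1 ≤ ·)
    (fun a b ha hb => ha.trans (le_mul_of_one_le_right (zero_le) hb)) le_rfl fun a _ => h a))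

/-- When `w t < 1`, every factor `t - c a` with `a ≠ i₀` is a unit, so the product has value exactly
`w t`, while the error terms force it to be smaller unless `t = 0`. -/
theorem eq_zero_of_eval_add_eq {i₀ : ι} (h0 : c i₀ = 0) (hc : ∀ a ≠ i₀, w (c a) = 1)
    (ht : (∏ a, (X - C (c a))).eval (t + x) = (∏ a, (X - C (c a))).eval x) (ht1 : w t < 1) :
    t = 0 := by
  classical
  by_contra htne
  have := valuation_eval_lt_of_eval_add_eq w hD h0 htne ht1.le ht
  rw [eval_prod, map_prod, Fintype.prod_eq_single i₀] at this
  · simp [h0] at this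
  · intro a ha
    simp only [eval_sub, eval_X, eval_C]
    rw [w.map_sub_eq_of_lt_right (by rwa [hc a ha]), hc a ha]

/-- The linear coefficient is a product of units up to sign, and the derivative at `x` is congruent
to it. This yields separability in every characteristic of `K`. -/
theorem eval_derivative_ne_zero_of_taylor {i₀ : ι} (h0 : c i₀ = 0) (hc : ∀ a ≠ i₀, w (c a) = 1) :
    (derivative (∏ a, (X - C (c a)))).eval x ≠ 0 := by
  classical
  have h1 := hD 1 one_ne_zero
  intro h
  rw [taylor_coeff_one, h, zero_sub, w.map_neg] at h1
  rw [← Finset.mul_prod_erase _ _ (Finset.mem_univ i₀), h0, C_0, sub_zero, coeff_X_mul,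
    coeff_zero_eq_eval_zero, eval_prod, map_prod, Finset.prod_eq_one] at h1
  · exact h1.false
  · intro a ha
    simp [hc a (Finset.ne_of_mem_erase ha)]

end RootDifference

/-! ### Ramification index and degree -/

section Ramification

variable {K M Γ ι : Type*} [Field K] [Field M] [Algebra K M] [LinearOrderedCommGroupWithZero Γ]

/-- Nonzero elements whose values lie in pairwise distinct cosets of the value group of `K` are
linearly independent over `K`. -/
theorem linearIndependent_of_valuation_ne (w : Valuation M Γ) (y : ι → M) (hy : ∀ i, y i ≠ 0)
    (h : ∀ i j, i ≠ j → ∀ a b : K, a ≠ 0 → b ≠ 0 →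
      w (algebraMap K M a * y i) ≠ w (algebraMap K M b * y j)) :
    LinearIndependent K y := by
  classical
  rw [linearIndependent_iff']
  intro s g hg
  by_contra! hne
  obtain ⟨i₁, hi₁, hgi₁⟩ := hne
  have hs : ({i ∈ s | g i ≠ 0} : Finset ι).Nonempty := ⟨i₁, by simp [hi₁, hgi₁]⟩
  obtain ⟨j, hj, hmax⟩ := Finset.exists_max_image _ (fun i => w (algebraMap K M (g i) * y i)) hs
  rw [Finset.mem_filter] at hj
  have hj0 : w (algebraMap K M (g j) * y j) ≠ 0 := by
    rw [w.ne_zero_iff]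
    exact mul_ne_zero ((_root_.map_ne_zero _).2 hj.2) (hy j)
  simp only [Algebra.smul_def] at hg
  have hlt : ∀ i ∈ s \ {j}, w (algebraMap K M (g i) * y i) < w (algebraMap K M (g j) * y j) := by
    intro i hi
    rw [Finset.mem_sdiff, Finset.mem_singleton] at hi
    by_cases hgi : g i = 0
    · simpa [hgi, zero_lt_iff] using hj0
    · exact lt_of_le_of_ne (hmax i (by simp [hi.1, hgi])) (h i j hi.2 _ _ hgi hj.2)
  have := w.map_sum_eq_of_lt (f := fun i => algebraMap K M (g i) * y i) hj.1 hlt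
  rw [hg, map_zero] at this
  exact hj0 this.symm

end Ramification

section

variable {K M : Type u} [Field K] [Field M] [Algebra K M] (B : ValuationSubring M)

theorem mem_baseValueGroup_iff (γ : B.ValueGroupˣ) :
    γ ∈ HDV.baseValueGroup K B ↔ ∃ a : K, a ≠ 0 ∧ B.valuation (algebraMap K M a) = γ := by
  constructor
  · rintro ⟨a, rfl⟩
    exact ⟨a, a.ne_zero, rfl⟩
  · rintro ⟨a, ha, h⟩
    exact ⟨Units.mk0 a ha, Units.ext h⟩

/-- The fundamental inequality `e ≤ n`. -/
theorem ramificationIndex_ne_zero_and_le_finrank [FiniteDimensional K M] :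
    HDV.ramificationIndex K B ≠ 0 ∧ HDV.ramificationIndex K B ≤ Module.finrank K M := by
  have hrep : ∀ g : B.ValueGroupˣ ⧸ HDV.baseValueGroup K B, ∃ (γ : B.ValueGroupˣ) (y : M),
      (γ : B.ValueGroupˣ ⧸ HDV.baseValueGroup K B) = g ∧ B.valuation y = γ := by
    intro g
    obtain ⟨γ, rfl⟩ := QuotientGroup.mk_surjective g
    obtain ⟨y, hy⟩ := B.valuation_surjective γ
    exact ⟨γ, y, rfl, hy⟩
  choose γ y hγ hy using hrep
  have hli : LinearIndependent K y := by
    refine linearIndependent_of_valuation_ne B.valuation y ?_ ?_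
    · intro g h
      have := hy g
      rw [h, map_zero] at this
      exact (γ g).ne_zero this.symm
    · intro g g' hgg a b ha hb h
      refine hgg ?_
      rw [← hγ g, ← hγ g', QuotientGroup.eq, mem_baseValueGroup_iff]
      refine ⟨a / b, div_ne_zero ha hb, ?_⟩
      rw [map_mul, map_mul, hy, hy] at h
      have hb' : B.valuation (algebraMap K M b) ≠ 0 := by simpa using hb
      rw [map_div₀, map_div₀, Units.val_mul, Units.val_inv_eq_inv_val, div_eq_iff hb',
        mul_assoc, eq_inv_mul_iff_mul_eq₀ (γ g).ne_zero, mul_comm, h, mul_comm]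
  have := hli.finite
  have := Fintype.ofFinite (B.ValueGroupˣ ⧸ HDV.baseValueGroup K B)
  have hle := hli.fintype_card_le_finrank
  rw [HDV.ramificationIndex, Subgroup.index, Nat.card_eq_fintype_card]
  exact ⟨Fintype.card_ne_zero, hle⟩

/-- The `e`-th power of `w x` lies in the base value group, hence is a power of `w π`; comparing
exponents after raising to the `q` gives `q ∣ e`. -/
theorem dvd_ramificationIndex {π : K} {x : M} {q : ℕ}
    (hπ : B.valuation (algebraMap K M π) < 1) (hπ0 : π ≠ 0)
    (hgen : ∀ a : K, a ≠ 0 → ∃ m : ℤ,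
      B.valuation (algebraMap K M a) = B.valuation (algebraMap K M π) ^ m)
    (hx0 : x ≠ 0) (hx : B.valuation x ^ q = (B.valuation (algebraMap K M π))⁻¹) :
    q ∣ HDV.ramificationIndex K B := by
  have hx0' : B.valuation x ≠ 0 := by simpa using hx0
  have hp0 : B.valuation (algebraMap K M π) ≠ 0 := by simpa using hπ0
  set e := HDV.ramificationIndex K B with he
  have hmem : (Units.mk0 _ hx0') ^ e ∈ HDV.baseValueGroup K B :=
    Subgroup.pow_index_mem _ _
  rw [mem_baseValueGroup_iff] at hmem
  obtain ⟨a, ha, hae⟩ := hmem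
  obtain ⟨m, hm⟩ := hgen a ha
  rw [hm, Units.val_pow_eq_pow_val, Units.val_mk0] at hae
  have h1 : B.valuation (algebraMap K M π) ^ (m * q) =
      B.valuation (algebraMap K M π) ^ (-(e : ℤ)) := by
    rw [zpow_mul, zpow_natCast, hae, ← pow_mul, mul_comm, pow_mul, hx, zpow_neg, inv_pow,
      zpow_natCast]
  have h2 : m * q = -(e : ℤ) :=
    zpow_right_injective₀ (zero_lt_iff.2 hp0) hπ.ne h1
  have : (q : ℤ) ∣ (e : ℤ) := ⟨-m, by rw [mul_neg, mul_comm, h2, neg_neg]⟩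
  exact_mod_cast this

end

/-! ### Finite groups of residues and the Galois group -/

theorem exists_addSubgroup_card_eq_pow (k : Type*) [Field k] [Infinite k] (p : ℕ)
    [Fact p.Prime] [CharP k p] (n : ℕ) : ∃ V : AddSubgroup k, Nat.card V = p ^ n := by
  let _ : Algebra (ZMod p) k := ZMod.algebra k p
  have hinf : ¬ Module.Finite (ZMod p) k := fun h =>
    not_finite_iff_infinite.2 ‹_› (Module.finite_of_finite (ZMod p))
  have hrank : (n : Cardinal) ≤ Module.rank (ZMod p) k :=
    Cardinal.natCast_lt_aleph0.le.trans
      (not_lt.1 fun h => hinf (Module.rank_lt_aleph0_iff.1 h))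
  obtain ⟨b, hb⟩ := Module.le_rank_iff.1 hrank
  refine ⟨(Submodule.span (ZMod p) (Set.range b)).toAddSubgroup, ?_⟩
  have : Module.Finite (ZMod p) (Submodule.span (ZMod p) (Set.range b)) :=
    Module.Finite.span_of_finite _ (Set.finite_range b)
  change Nat.card (Submodule.span (ZMod p) (Set.range b)) = _
  rw [Module.natCard_eq_pow_finrank (K := ZMod p), finrank_span_eq_card hb]
  simp

/-- The map sends `σ` to the class of `σ x - x` for a fixed root `x`. Since `σ` fixes the `c a` and
preserves smallness, this is additive, and a `σ` fixing `x` moves every other root by a small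
amount, hence not at all. -/
theorem exists_injective_hom_of_valuation {K M Γ V : Type*} [Field K] [Field M] [Algebra K M]
    [LinearOrderedCommGroupWithZero Γ] [AddCommGroup V] (w : Valuation M Γ)
    (hw : ∀ (σ : Gal(M/K)) (z : M), w z < 1 → w (σ z) < 1) (c : V → K)
    (hadd : ∀ a b, w (algebraMap K M (c (a + b) - c a - c b)) < 1)
    (hinj : ∀ a b, w (algebraMap K M (c a - c b)) < 1 → a = b) (R : Set M)
    (hR : ∀ (σ : Gal(M/K)), ∀ y ∈ R, σ y ∈ R)
    (hgen : ∀ σ : Gal(M/K), (∀ y ∈ R, σ y = y) → σ = 1)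
    (hex : ∀ x ∈ R, ∀ y ∈ R, ∃ a, w (y - x - algebraMap K M (c a)) < 1)
    (heq : ∀ x ∈ R, ∀ y ∈ R, w (y - x) < 1 → y = x) (hne : R.Nonempty) :
    ∃ δ : Gal(M/K) →* Multiplicative V, Function.Injective δ := by
  obtain ⟨x, hx⟩ := hne
  choose δ hδ using fun σ : Gal(M/K) => hex x hx (σ x) (hR σ x hx)
  have huniq : ∀ σ a, w (σ x - x - algebraMap K M (c a)) < 1 → δ σ = a := by
    intro σ a h
    refine hinj _ _ ?_
    have : algebraMap K M (c (δ σ) - c a) =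
        (σ x - x - algebraMap K M (c a)) - (σ x - x - algebraMap K M (c (δ σ))) := by
      rw [map_sub]; ring
    rw [this]
    exact w.map_sub_lt h (hδ σ)
  have hmul : ∀ σ τ, δ (σ * τ) = δ σ + δ τ := by
    intro σ τ
    refine huniq _ _ ?_
    have : (σ * τ) x - x - algebraMap K M (c (δ σ + δ τ)) =
        σ (τ x - x - algebraMap K M (c (δ τ))) + (σ x - x - algebraMap K M (c (δ σ))) -
          algebraMap K M (c (δ σ + δ τ) - c (δ σ) - c (δ τ)) := by
      simp only [map_sub, AlgEquiv.commutes, AlgEquiv.mul_apply]; ring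
    rw [this]
    exact w.map_sub_lt (w.map_add_lt (hw _ _ (hδ τ)) (hδ σ)) (hadd _ _)
  refine ⟨MonoidHom.mk' (fun σ => Multiplicative.ofAdd (δ σ)) fun σ τ => by rw [hmul]; rfl, ?_⟩
  rw [injective_iff_map_eq_one]
  intro σ hσ
  have hσ0 : δ σ = 0 := hσ
  have h10 : δ 1 = 0 := by simpa using hmul 1 1
  have hσx : σ x = x := by
    refine heq x hx _ (hR σ x hx) ?_
    have h1 := hδ σ
    have h2 := hδ 1
    rw [hσ0] at h1
    rw [h10, AlgEquiv.one_apply] at h2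
    have := w.map_sub_lt h1 h2
    rwa [show σ x - x - algebraMap K M (c 0) - (x - x - algebraMap K M (c 0)) = σ x - x by ring]
      at this
  refine hgen σ fun y hy => heq y hy _ (hR σ y hy) ?_
  obtain ⟨a, ha⟩ := hex x hx y hy
  have := w.map_sub_lt (hw σ _ ha) ha
  simp only [map_sub, AlgEquiv.commutes, hσx] at this
  rwa [show σ y - x - algebraMap K M (c a) - (y - x - algebraMap K M (c a)) = σ y - y by ring]
    at this

/-! ### Prolongations of the discrete valuation -/

namespace HDV

section

variable {K : Type u} [Field K] {Γ₀ : Type w} [LinearOrderedCommGroupWithZero Γ₀]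
  {v : Valuation K Γ₀} {M : Type u} [Field M] [Algebra K M] {B : ValuationSubring M}

theorem Extends.isEquiv (hB : Extends v B) :
    (B.valuation.comap (algebraMap K M)).IsEquiv v := by
  refine Valuation.isEquiv_of_val_le_one fun {a} => ?_
  rw [Valuation.comap_apply, B.valuation_le_one_iff, ← ValuationSubring.mem_comap, hB,
    Valuation.mem_valuationSubring_iff]

theorem Extends.map_lt_one_of_unique (hB : Extends v B)
    (huniq : ∀ B' : ValuationSubring M, Extends v B' → B' = B) (σ : Gal(M/K)) (z : M)
    (hz : B.valuation z < 1) : B.valuation (σ z) < 1 := by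
  have hσ : B.comap (σ : M →+* M) = B := by
    refine huniq _ ?_
    rw [Extends, ← hB]
    ext a
    simp [ValuationSubring.mem_comap]
  have he : (B.valuation.comap (σ : M →+* M)).IsEquiv B.valuation := by
    refine Valuation.isEquiv_of_val_le_one fun {a} => ?_
    rw [Valuation.comap_apply, B.valuation_le_one_iff, B.valuation_le_one_iff,
      ← ValuationSubring.mem_comap, hσ]
  exact he.lt_one_iff_lt_one.2 hz

theorem exists_zpow_eq [v.IsRankOneDiscrete] {π : K} (hπ : v.IsUniformizer π) {a : K}
    (ha : a ≠ 0) : ∃ m : ℤ, v a = v π ^ m := by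
  have h : v a ∈ Set.range v \ {0} := ⟨⟨a, rfl⟩, by simpa using ha⟩
  rw [← Valuation.IsRankOneDiscrete.generator_zpowers_eq_range] at h
  obtain ⟨_, ⟨m, rfl⟩, hm⟩ := h
  exact ⟨m, by rw [← hm, hπ.val]; simp⟩

theorem Extends.exists_zpow_eq [v.IsRankOneDiscrete] (hB : Extends v B) {π : K}
    (hπ : v.IsUniformizer π) {a : K} (ha : a ≠ 0) :
    ∃ m : ℤ, B.valuation (algebraMap K M a) = B.valuation (algebraMap K M π) ^ m := by
  obtain ⟨m, hm⟩ := HDV.exists_zpow_eq hπ ha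
  refine ⟨m, ?_⟩
  rw [← map_zpow₀ v] at hm
  rw [← map_zpow₀, ← map_zpow₀]
  exact hB.isEquiv.eq_iff.2 hm

theorem le_of_lt_one [v.IsRankOneDiscrete] {π : K} (hπ : v.IsUniformizer π) {a : K}
    (ha : v a < 1) : v a ≤ v π := by
  rcases eq_or_ne a 0 with rfl | ha0
  · simp
  obtain ⟨m, hm⟩ := exists_zpow_eq hπ ha0
  rw [hm] at ha ⊢
  have hm1 : 0 < m := by
    by_contra! h
    exact absurd ha (not_lt.2 (one_le_zpow_of_nonpos₀ hπ.val_pos hπ.val_lt_one.le h))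
  calc v π ^ m ≤ v π ^ (1 : ℤ) := zpow_le_zpow_right_of_le_one₀ hπ.val_pos hπ.val_lt_one.le hm1
    _ = v π := zpow_one _

end

end HDV

theorem Polynomial.separable_of_splits_of_eval_derivative_ne_zero {K M : Type*} [Field K] [Field M]
    [Algebra K M] {G : K[X]} (hG0 : G ≠ 0) (hG : (G.map (algebraMap K M)).Splits)
    (h : ∀ y : M, (G.map (algebraMap K M)).eval y = 0 →
      (derivative (G.map (algebraMap K M))).eval y ≠ 0) : G.Separable := by
  classical
  rw [← nodup_aroots_iff_of_splits hG0 hG, aroots, Multiset.nodup_iff_count_le_one]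
  intro y
  rw [count_roots]
  by_contra! hlt
  have := (one_lt_rootMultiplicity_iff_isRoot ((Polynomial.map_ne_zero_iff
    (algebraMap K M).injective).2 hG0)).1 hlt
  exact h y this.1 this.2

namespace HDV

section

variable {K : Type u} [Field K] {Γ₀ : Type w} [LinearOrderedCommGroupWithZero Γ₀]
  {v : Valuation K Γ₀} {M : Type u} [Field M] [Algebra K M] {B : ValuationSubring M}

theorem Extends.le_one (hB : Extends v B) (a : v.valuationSubring) :
    B.valuation (algebraMap K M a) ≤ 1 :=
  hB.isEquiv.le_one_iff_le_one.2 a.2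

theorem Extends.lt_one_iff_residue_eq_zero (hB : Extends v B) (a : v.valuationSubring) :
    B.valuation (algebraMap K M a) < 1 ↔ IsLocalRing.residue v.valuationSubring a = 0 := by
  rw [IsLocalRing.residue_eq_zero_iff, IsLocalRing.mem_maximalIdeal, mem_nonunits_iff]
  have hu : IsUnit a ↔ v (a : K) = 1 :=
    Valuation.Integers.isUnit_iff_valuation_eq_one (Valuation.integer.integers v)
  rw [hu]
  have : B.valuation (algebraMap K M a) < 1 ↔ v a < 1 := hB.isEquiv.lt_one_iff_lt_one
  rw [this]
  exact (lt_iff_le_and_ne.trans (and_iff_right a.2))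

theorem Extends.valuation_root_pow_eq (hB : Extends v B) {ι : Type*} [Fintype ι]
    (c : ι → v.valuationSubring) {π : K} (hπ0 : π ≠ 0) (hπ : v π < 1) {x : M}
    (hx : (∏ i, (X - C (algebraMap K M (c i)))).eval x = algebraMap K M π⁻¹) :
    1 < B.valuation x ∧
      B.valuation x ^ Fintype.card ι = (B.valuation (algebraMap K M π))⁻¹ := by
  have hwπ : B.valuation (algebraMap K M π) < 1 := hB.isEquiv.lt_one_iff_lt_one.2 hπ
  have hwπ0 : 0 < B.valuation (algebraMap K M π) := by
    rw [zero_lt_iff, Valuation.ne_zero_iff]; simpa using hπ0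
  have h1 : 1 < B.valuation x := by
    by_contra! h
    have h2 : B.valuation ((∏ i, (X - C (algebraMap K M (c i)))).eval x) ≤ 1 := by
      rw [eval_prod, map_prod]
      refine Finset.prod_induction _ (· ≤ 1) (fun a b => mul_le_one') le_rfl fun i _ => ?_
      simp only [eval_sub, eval_X, eval_C]
      exact B.valuation.map_sub_le h (hB.le_one _)
    rw [hx, map_inv₀, map_inv₀] at h2
    exact absurd h2 (not_le.2 ((one_lt_inv₀ hwπ0).2 hwπ))
  refine ⟨h1, ?_⟩
  rw [← valuation_eval_prod_eq_pow B.valuation (fun i => hB.le_one (c i)) h1, hx, map_inv₀,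
    map_inv₀]

/-- The additive polynomial attached to a finite group of residues remains additive, up to small
terms, at the points where it takes the value `π⁻¹`. -/
theorem Extends.taylor_coeff_sub_lt_one [v.IsRankOneDiscrete] (hB : Extends v B)
    [Infinite (IsLocalRing.ResidueField v.valuationSubring)]
    (V : AddSubgroup (IsLocalRing.ResidueField v.valuationSubring)) [Fintype V]
    (c : V → v.valuationSubring)
    (hc : ∀ a, IsLocalRing.residue v.valuationSubring (c a) = a) {π : K}
    (hπ : v.IsUniformizer π) {x : M}
    (hx : (∏ i, (X - C (algebraMap K M (c i)))).eval x = algebraMap K M π⁻¹)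
    (j : ℕ) (hj : j ≠ 0) :
    B.valuation ((taylor x (∏ i, (X - C (algebraMap K M (c i))))).coeff j -
      (∏ i, (X - C (algebraMap K M (c i)))).coeff j) < 1 := by
  obtain ⟨h1, h2⟩ := hB.valuation_root_pow_eq c hπ.ne_zero hπ.val_lt_one hx
  let φ : v.valuationSubring →+* M := (algebraMap K M).comp v.valuationSubring.subtype
  have hmap : (∏ i, (X - C (algebraMap K M (c i)))) = (∏ i, (X - C (c i))).map φ := by
    simp [Polynomial.map_prod, φ]
  have hres : (∏ i, (X - C (c i))).map (IsLocalRing.residue v.valuationSubring) =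
      ∏ a : V, (X - C (a : IsLocalRing.ResidueField v.valuationSubring)) := by
    simp [Polynomial.map_prod, hc]
  have hdeg : (∏ i, (X - C (c i))).natDegree = Fintype.card V := by
    rw [natDegree_prod_of_monic _ _ fun a _ => monic_X_sub_C _]; simp
  have hwπ0 : 0 < B.valuation (algebraMap K M π) := by
    rw [zero_lt_iff, Valuation.ne_zero_iff]; simpa using hπ.ne_zero
  rw [hmap]
  refine valuation_taylor_coeff_sub_lt_one B.valuation φ (ρ := B.valuation (algebraMap K M π))
    ?_ _ ?_ hj ?_
  · intro a ha
    have hlt : v a < 1 := by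
      refine hB.isEquiv.lt_one_iff_lt_one.1 ((hB.lt_one_iff_residue_eq_zero a).2 ?_)
      rwa [IsLocalRing.residue_eq_zero_iff]
    exact (hB.isEquiv a π).2 (le_of_lt_one hπ hlt)
  · intro i hi
    rw [hdeg] at hi
    -- The gain of a full factor `w π` outweighs `w x ^ i` exactly as long as `i < q`.
    calc _ < B.valuation (algebraMap K M π) * B.valuation x ^ Fintype.card V :=
          mul_lt_mul_of_pos_left (pow_lt_pow_right₀ h1 hi) hwπ0
      _ = 1 := by rw [h2, mul_inv_cancel₀ hwπ0.ne']
  · rw [hres]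
    exact hasseDeriv_prod_X_sub_C_addSubgroup V hj

end

end HDV

/-! ### The extension itself -/

theorem lemma2p3 {K : Type u} [Field K] {Γ₀ : Type w} [LinearOrderedCommGroupWithZero Γ₀]
    (v : Valuation K Γ₀) [v.IsRankOneDiscrete] (hv : HDV.IsHenselian v)
    (p : ℕ) (hp : 0 < p)
    [CharP (IsLocalRing.ResidueField v.valuationSubring) p]
    [Infinite (IsLocalRing.ResidueField v.valuationSubring)]
    (μ : ℕ) (hμ : 0 < μ) :
    ∃ (M : Type u) (_ : Field M) (_ : Algebra K M),
      HDV.IsTotallyRamified v M ∧ Module.finrank K M = p ^ μ ∧ IsGalois K M ∧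
        (∀ σ τ : Gal(M/K), σ * τ = τ * σ) ∧ Monoid.exponent Gal(M/K) = p := by
  classical
  let k := IsLocalRing.ResidueField v.valuationSubring
  have hpp : p.Prime := (CharP.char_is_prime_or_zero k p).resolve_right hp.ne'
  have : Fact p.Prime := ⟨hpp⟩
  obtain ⟨V, hV⟩ := exists_addSubgroup_card_eq_pow k p μ
  have : Finite V := Nat.finite_of_card_ne_zero (hV ▸ pow_ne_zero _ hp.ne')
  have := Fintype.ofFinite V
  have hcard : Fintype.card V = p ^ μ := by rw [← hV, Nat.card_eq_fintype_card]
  obtain ⟨c, hc, hc0⟩ : ∃ c : V → v.valuationSubring,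
      (∀ a, IsLocalRing.residue v.valuationSubring (c a) = a) ∧ c 0 = 0 := by
    have hs : Function.Surjective (IsLocalRing.residue v.valuationSubring) :=
      IsLocalRing.residue_surjective
    -- The lift of `0` is taken to be exactly `0`, so that the product has no constant term.
    refine ⟨Function.update (fun a => Function.surjInv hs a) 0 0, fun a => ?_, by simp⟩
    rcases eq_or_ne a 0 with rfl | ha
    · simp
    · rw [Function.update_of_ne ha, Function.surjInv_eq hs]
  obtain ⟨π, hπ⟩ := Valuation.IsRankOneDiscrete.generator_mem_range K v
  replace hπ : v.IsUniformizer π := hπ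
  let f : K[X] := ∏ a : V, (X - C (c a : K))
  have hfm : f.Monic := monic_prod_of_monic _ _ fun a _ => monic_X_sub_C _
  have hfd : f.natDegree = Fintype.card V := natDegree_prod_X_sub_C' _
  have hVpos : 0 < Fintype.card V := Fintype.card_pos
  let G : K[X] := f - C π⁻¹
  have hGd : G.natDegree = Fintype.card V := by rw [natDegree_sub_C, hfd]
  have hG0 : G ≠ 0 := ne_zero_of_natDegree_gt (hGd.symm ▸ hVpos)
  let M := G.SplittingField
  have hsplit : (G.map (algebraMap K M)).Splits := SplittingField.splits G
  obtain ⟨B, hB, huniq⟩ := hv M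
  let F : M[X] := ∏ a : V, (X - C (algebraMap K M (c a)))
  have hGF : G.map (algebraMap K M) = F - C (algebraMap K M π⁻¹) := by
    simp [G, f, F, Polynomial.map_prod]
  have hroot : ∀ y : M, (G.map (algebraMap K M)).eval y = 0 ↔
      F.eval y = algebraMap K M π⁻¹ := by
    intro y
    rw [hGF, eval_sub, eval_C, sub_eq_zero]
  have hD := fun (y : M) (hy : F.eval y = algebraMap K M π⁻¹) =>
    hB.taylor_coeff_sub_lt_one V c hc hπ hy
  have hc0' : algebraMap K M (c 0) = 0 := by simp [hc0]
  have hc1 : ∀ a ≠ 0, B.valuation (algebraMap K M (c a)) = 1 := by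
    intro a ha
    refine le_antisymm (hB.le_one _) (not_lt.1 fun h => ha ?_)
    rw [hB.lt_one_iff_residue_eq_zero, hc] at h
    exact Subtype.ext h
  have hsep : G.Separable := by
    refine separable_of_splits_of_eval_derivative_ne_zero hG0 hsplit fun y hy => ?_
    rw [hGF, derivative_sub, derivative_C, sub_zero]
    exact eval_derivative_ne_zero_of_taylor B.valuation (hD y ((hroot y).1 hy)) hc0' hc1
  have hgal : IsGalois K M := IsGalois.of_separable_splitting_field hsep
  have hfin : FiniteDimensional K M := inferInstance
  obtain ⟨x, hx⟩ : ∃ x : M, F.eval x = algebraMap K M π⁻¹ := by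
    obtain ⟨x, hx⟩ := hsplit.exists_eval_eq_zero
      (by rw [degree_map, degree_eq_natDegree hG0, hGd]; exact_mod_cast hVpos.ne')
    exact ⟨x, (hroot x).1 hx⟩
  obtain ⟨δ, hδ⟩ : ∃ δ : Gal(M/K) →* Multiplicative V, Function.Injective δ := by
    refine exists_injective_hom_of_valuation B.valuation
      (fun σ z => hB.map_lt_one_of_unique huniq σ z) (fun a => (c a : K)) ?_ ?_
      {y | F.eval y = algebraMap K M π⁻¹} ?_ ?_ ?_ ?_ ⟨x, hx⟩
    · intro a b
      refine (hB.lt_one_iff_residue_eq_zero (c (a + b) - c a - c b)).2 ?_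
      simp [hc]
    · intro a b h
      have := (hB.lt_one_iff_residue_eq_zero (c a - c b)).1 h
      rw [map_sub, hc, hc, sub_eq_zero] at this
      exact Subtype.ext this
    · intro σ y hy
      rw [Set.mem_ofPred_eq, ← hroot, eval_map_algebraMap] at hy ⊢
      rw [aeval_algHom_apply, hy, map_zero]
    · intro σ hσ
      refine Gal.ext (p := G) fun y hy => ?_
      rw [mem_rootSet, ← eval_map_algebraMap] at hy
      exact hσ y ((hroot y).1 hy.2)
    · intro x hx y hy
      refine exists_valuation_sub_lt_one_of_eval_add_eq B.valuation (hD x hx) hc0'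
        (fun a => hB.le_one _) ?_
      rw [sub_add_cancel]
      exact hy.trans hx.symm
    · intro x hx y hy h
      refine sub_eq_zero.1 (eq_zero_of_eval_add_eq B.valuation (hD x hx) hc0' hc1 ?_ h)
      rw [sub_add_cancel]
      exact hy.trans hx.symm
  have hle : Module.finrank K M ≤ p ^ μ := by
    rw [← IsGalois.card_aut_eq_finrank, ← hV]
    exact Nat.card_le_card_of_injective δ hδ
  obtain ⟨hx1, hxq⟩ := hB.valuation_root_pow_eq c hπ.ne_zero hπ.val_lt_one hx
  have hdvd : p ^ μ ∣ HDV.ramificationIndex K B := by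
    rw [← hcard]
    refine dvd_ramificationIndex B (hB.isEquiv.lt_one_iff_lt_one.2 hπ.val_lt_one) hπ.ne_zero
      (fun a ha => hB.exists_zpow_eq hπ ha) ?_ hxq
    rintro rfl
    simp at hx1
  obtain ⟨he0, hen⟩ := ramificationIndex_ne_zero_and_le_finrank (K := K) B
  have hge := Nat.le_of_dvd (Nat.pos_of_ne_zero he0) hdvd
  have hfr : Module.finrank K M = p ^ μ := le_antisymm hle (hge.trans hen)
  refine ⟨M, inferInstance, inferInstance, ⟨hfin, B, hB, huniq, ?_⟩, hfr, hgal, ?_, ?_⟩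
  · exact le_antisymm hen (hfr ▸ hge)
  · intro σ τ
    apply hδ
    rw [map_mul, map_mul, mul_comm]
  · have hexp : Monoid.exponent Gal(M/K) ∣ p := by
      refine Monoid.exponent_dvd_of_forall_pow_eq_one fun σ => hδ ?_
      rw [map_pow, map_one]
      refine Multiplicative.toAdd.injective (Subtype.ext ?_)
      simp
    -- Exponent `1` would make the group trivial, contrary to its order `p ^ μ` with `μ > 0`.
    refine (hpp.eq_one_or_self_of_dvd _ hexp).resolve_left fun h => ?_
    have := Monoid.exp_eq_one_iff.1 h
    have h1 : Nat.card Gal(M/K) = 1 := Nat.card_unique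
    rw [IsGalois.card_aut_eq_finrank, hfr] at h1
    exact (Nat.one_lt_pow hμ.ne' hpp.one_lt).ne' h1
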